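/- Let $A$ be a finite dimensional $C^*$-algebra, let $H$ and $K$ be finite dimensional complex Hilbert spaces, and let $\rho\colon A\to B(K)$ be a faithful (injective) $*$-representation, through which $A$ is regarded as a $C^*$-subalgebra of $B(K)$. Let $t$ denote the transpose map on $B(H)$ with respect to a fixed orthonormal basis of $H$. For a linear operator $v\colon H\to K$ let $\mathrm{Ad}\,v\colon B(K)\to B(H)$ be the map $x\mapsto v^*xv$. A linear map $\varphi\colon A\to B(H)$ is called positive if it carries positive elements to positive elements, and $\varphi$ majorizes $\psi$, written $\varphi\ge\psi$, if $\varphi-\psi$ is positive. It is $k$-positive if $\iota_k\otimes\varphi\colon M_k(A)\to M_k(B(H))$ is positive, completely positive if it is $k$-positive for all $k$, and $k$-co-positive (respectively co-positive) if $t\circ\varphi$ is $k$-positive (respectively completely positive). It is atomic if it is not the sum of a $2$-positive and a $2$-co-positive map. It is extreme if every positive map $\psi$ with $\varphi\ge\psi$ is of the form $\psi=\lambda\varphi$ with $\lambda\ge 0$. It is bi-optimal if $\psi=0$ whenever $\varphi\ge\psi$ and $\psi\colon A\to B(H)$ is completely positive or co-positive. Let $\varphi\colon A\to B(H)$ be a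 positive map which is extreme. Then at least one of the following holds: (i) $\varphi=\mathrm{Ad}\,v\circ\rho$, that is, $\varphi(a)=v^*\rho(a)v$ for all $a\in A$, for some linear $v\colon H\to K$; (ii) $\varphi=t\circ\mathrm{Ad}\,v\circ\rho$, that is, $\varphi(a)=t(v^*\rho(a)v)$ for all $a\in A$, for some linear $v\colon H\to K$; (iii) $\varphi$ is bi-optimal and atomic. -/

import Mathlib

open scoped InnerProductSpace

namespace PosMaps

noncomputable section

section Abstract

variable {A B : Type*} [CStarAlgebra A] [PartialOrder A] [StarOrderedRing A]
  [CStarAlgebra B] [PartialOrder B] [StarOrderedRing B]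

/-- A linear map is positive if it carries positive elements to positive elements. -/
def IsPositive (φ : A →ₗ[ℂ] B) : Prop :=
  ∀ a : A, 0 ≤ a → 0 ≤ φ a

/-- `φ` majorizes `ψ` (that is, `φ ≥ ψ`) if `φ - ψ` is positive. -/
def Majorizes (φ ψ : A →ₗ[ℂ] B) : Prop :=
  IsPositive (φ - ψ)

/-- `φ` is `k`-positive if `ι_k ⊗ φ : M_k(A) → M_k(B)`, which applies `φ` to every entry,
carries positive elements to positive elements. -/
def IsKPositive (k : ℕ) (φ : A →ₗ[ℂ] B) : Prop :=
  ∀ M : CStarMatrix (Fin k) (Fin k) A, 0 ≤ M → 0 ≤ M.map φ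

/-- `φ` is completely positive if it is `k`-positive for all `k`. -/
def IsCompletelyPositive (φ : A →ₗ[ℂ] B) : Prop :=
  ∀ k : ℕ, IsKPositive k φ

/-- `φ` is extreme if every positive map that it majorizes is a nonnegative multiple of it. -/
def IsExtreme (φ : A →ₗ[ℂ] B) : Prop :=
  ∀ ψ : A →ₗ[ℂ] B, IsPositive ψ → Majorizes φ ψ → ∃ c : ℝ, 0 ≤ c ∧ ψ = (c : ℂ) • φ

/-- `φ` is optimal if it majorizes no nonzero completely positive map. -/
def IsOptimal (φ : A →ₗ[ℂ] B) : Prop :=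
  ∀ ψ : A →ₗ[ℂ] B, IsCompletelyPositive ψ → Majorizes φ ψ → ψ = 0

end Abstract

section Transpose

variable {H ι : Type*} [NormedAddCommGroup H] [InnerProductSpace ℂ H]
  [FiniteDimensional ℂ H] [CompleteSpace H] [Fintype ι] [DecidableEq ι]

/-- The transpose map on `B(H)` with respect to the orthonormal basis `b`. -/
def transpose (b : OrthonormalBasis ι ℂ H) : (H →L[ℂ] H) →ₗ[ℂ] (H →L[ℂ] H) where
  toFun x := LinearMap.toContinuousLinearMap
    (Matrix.toLin b.toBasis b.toBasis
      (LinearMap.toMatrix b.toBasis b.toBasis (x : H →ₗ[ℂ] H)).transpose)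
  map_add' x y := by simp
  map_smul' c x := by simp

variable {A : Type*} [CStarAlgebra A] [PartialOrder A] [StarOrderedRing A]

/-- `φ` is `k`-co-positive if `t ∘ φ` is `k`-positive. -/
def IsKCoPositive (b : OrthonormalBasis ι ℂ H) (k : ℕ) (φ : A →ₗ[ℂ] (H →L[ℂ] H)) : Prop :=
  IsKPositive k (transpose b ∘ₗ φ)

/-- `φ` is co-positive if `t ∘ φ` is completely positive. -/
def IsCoPositive (b : OrthonormalBasis ι ℂ H) (φ : A →ₗ[ℂ] (H →L[ℂ] H)) : Prop :=
  IsCompletelyPositive (transpose b ∘ₗ φ)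

/-- `φ` is `k`-decomposable if it is the sum of a `k`-positive and a `k`-co-positive map. -/
def IsKDecomposable (b : OrthonormalBasis ι ℂ H) (k : ℕ) (φ : A →ₗ[ℂ] (H →L[ℂ] H)) : Prop :=
  ∃ φ₁ φ₂ : A →ₗ[ℂ] (H →L[ℂ] H), IsKPositive k φ₁ ∧ IsKCoPositive b k φ₂ ∧ φ = φ₁ + φ₂

/-- `φ` is atomic if it is not `2`-decomposable. -/
def IsAtomic (b : OrthonormalBasis ι ℂ H) (φ : A →ₗ[ℂ] (H →L[ℂ] H)) : Prop :=
  ¬ IsKDecomposable b 2 φ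

/-- `φ` is co-optimal if it majorizes no nonzero co-positive map. -/
def IsCoOptimal (b : OrthonormalBasis ι ℂ H) (φ : A →ₗ[ℂ] (H →L[ℂ] H)) : Prop :=
  ∀ ψ : A →ₗ[ℂ] (H →L[ℂ] H), IsCoPositive b ψ → Majorizes φ ψ → ψ = 0

/-- `φ` is bi-optimal if it is both optimal and co-optimal. -/
def IsBiOptimal (b : OrthonormalBasis ι ℂ H) (φ : A →ₗ[ℂ] (H →L[ℂ] H)) : Prop :=
  IsOptimal φ ∧ IsCoOptimal b φ

end Transpose

section Ad

variable {H K : Type*} [NormedAddCommGroup H] [InnerProductSpace ℂ H] [CompleteSpace H]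
  [NormedAddCommGroup K] [InnerProductSpace ℂ K] [CompleteSpace K]

/-- For `v : H → K`, the map `Ad v : B(K) → B(H)`, `x ↦ v* x v`. -/
def Ad (v : H →L[ℂ] K) : (K →L[ℂ] K) →ₗ[ℂ] (H →L[ℂ] H) where
  toFun x := ContinuousLinearMap.adjoint v ∘L x ∘L v
  map_add' x y := by simp
  map_smul' c x := by simp

end Ad

end

end PosMaps

/-! Only 2-positivity and 2-co-positivity of `φ` matter. If `φ` has neither, extremality gives
(iii): a nonzero completely positive or co-positive map below `φ`, or a nonzero 2-positive summand,
is proportional to `φ` and would pass its property on. If `φ` is nonzero and 2-positive, it suffices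
to find a nonzero map `Ad v ∘ ρ` below a multiple of `φ` (`IsKPositive.exists_majorizes_adComp`),
since extremality makes it proportional to `φ`. Choose `s`, `x`, `k` with `φ (star s * s) x ≠ 0` and
`⟪x, φ (star (a * s) * (a * s)) x⟫ ≤ c * ‖ρ a k‖ ^ 2`. By Cauchy–Schwarz for 2-positive maps, `ρ a k
↦ φ (a * s) x` is well defined; its adjoint is `v`, and Cauchy–Schwarz again gives the domination.
The 2-co-positive case follows by composing with the transpose. -/

namespace PosMaps

open scoped InnerProductSpace ComplexOrder

/-! ### Order ideals, minimal positive elements and extremality -/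

section Order

variable {A B : Type*} [CStarAlgebra A] [PartialOrder A] [StarOrderedRing A]
  [CStarAlgebra B] [PartialOrder B] [StarOrderedRing B]

/-- The real subspace of all elements `b` with `-c h ≤ b ≤ c h` for some `c ≥ 0`. -/
def orderIdeal (h : A) : Submodule ℝ A where
  carrier := {b | ∃ c : ℝ, 0 ≤ c ∧ -(c • h) ≤ b ∧ b ≤ c • h}
  zero_mem' := ⟨0, le_rfl, by simp, by simp⟩
  add_mem' := by
    rintro a b ⟨c, hc, h₁, h₂⟩ ⟨d, hd, h₃, h₄⟩
    refine ⟨c + d, add_nonneg hc hd, ?_, ?_⟩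
    · rw [add_smul, neg_add]; exact add_le_add h₁ h₃
    · rw [add_smul]; exact add_le_add h₂ h₄
  smul_mem' := by
    rintro r a ⟨c, hc, h₁, h₂⟩
    refine ⟨|r| * c, by positivity, ?_⟩
    rw [mul_smul]
    rcases le_total 0 r with hr | hr
    · rw [abs_of_nonneg hr, ← smul_neg]
      exact ⟨smul_le_smul_of_nonneg_left h₁ hr, smul_le_smul_of_nonneg_left h₂ hr⟩
    · have hr' : 0 ≤ -r := neg_nonneg.2 hr
      rw [abs_of_nonpos hr]
      have e₁ := smul_le_smul_of_nonneg_left h₁ hr'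
      have e₂ := smul_le_smul_of_nonneg_left h₂ hr'
      have e : r • a = -(-r • a) := by rw [neg_smul, neg_neg]
      rw [e]
      refine ⟨neg_le_neg e₂, ?_⟩
      rw [smul_neg] at e₁
      exact neg_le.1 e₁

theorem mem_orderIdeal_of_le {h b : A} (hh : 0 ≤ h) (hb : 0 ≤ b) {c : ℝ} (hc : 0 ≤ c)
    (hbc : b ≤ c • h) : b ∈ orderIdeal h :=
  ⟨c, hc, (neg_nonpos.2 (smul_nonneg hc hh)).trans hb, hbc⟩

theorem orderIdeal_mono {h b : A} (hbh : b ∈ orderIdeal h) :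
    orderIdeal b ≤ orderIdeal h := by
  rintro a ⟨c, hc, h₁, h₂⟩
  obtain ⟨d, hd, -, h₃⟩ := hbh
  have h₄ : c • b ≤ (c * d) • h := by
    rw [mul_smul]; exact smul_le_smul_of_nonneg_left h₃ hc
  exact ⟨c * d, mul_nonneg hc hd, (neg_le_neg h₄).trans h₁, h₂.trans h₄⟩

/-- A largest multiple of `h` below `b`. -/
theorem exists_maximal_smul_le {h b : A} (hh : 0 ≤ h) (h0 : h ≠ 0) (hb : 0 ≤ b) {c : ℝ}
    (hbc : b ≤ c • h) : ∃ t : ℝ, t • h ≤ b ∧ ∀ s : ℝ, s • h ≤ b → s ≤ t := by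
  have hbd : ∀ t ∈ {t : ℝ | t • h ≤ b}, t ≤ c := by
    intro t ht
    by_contra! hlt
    have h₁ : (t - c) • h ≤ 0 := by
      rw [sub_smul]; exact sub_nonpos.2 (le_trans ht hbc)
    have h₂ := smul_le_smul_of_nonneg_left h₁ (inv_nonneg.2 (sub_pos.2 hlt).le)
    rw [smul_smul, inv_mul_cancel₀ (sub_pos.2 hlt).ne', one_smul, smul_zero] at h₂
    exact h0 (le_antisymm h₂ hh)
  have hcl : IsClosed {t : ℝ | t • h ≤ b} :=
    isClosed_le (by fun_prop) continuous_const
  have hne : {t : ℝ | t • h ≤ b}.Nonempty := ⟨0, by simpa using hb⟩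
  exact ⟨_, hcl.csSup_mem hne ⟨c, hbd⟩, fun s hs => le_csSup ⟨c, hbd⟩ hs⟩

theorem exists_nonneg_map_ne_zero {φ : A →ₗ[ℂ] B} (h0 : φ ≠ 0) : ∃ h : A, 0 ≤ h ∧ φ h ≠ 0 := by
  by_contra! hcon
  refine h0 (LinearMap.ext_on (s := {a : A | 0 ≤ a}) CStarAlgebra.span_nonneg ?_)
  intro a ha
  simpa using hcon a ha

/-- A nonzero map on a finite dimensional algebra restricts, below some positive `h`
outside its kernel, to a multiple of a state. -/
theorem exists_nonneg_forall_le_map_eq_smul [FiniteDimensional ℂ A] {φ : A →ₗ[ℂ] B}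
    (h0 : φ ≠ 0) :
    ∃ h : A, 0 ≤ h ∧ φ h ≠ 0 ∧ ∀ (b : A) (c : ℝ), 0 ≤ c → 0 ≤ b → b ≤ c • h →
      ∃ t : ℝ, t • h ≤ b ∧ φ b = (t : ℂ) • φ h := by
  have : FiniteDimensional ℝ A := FiniteDimensional.complexToReal A
  obtain ⟨h₁, hh₁, hφ₁⟩ := exists_nonneg_map_ne_zero h0
  -- Among positive elements outside the kernel, take one whose order ideal has least dimension.
  obtain ⟨⟨h, hh⟩, hφ, hmin⟩ := WellFounded.has_min
    (measure fun h : {h : A // 0 ≤ h} => Module.finrank ℝ (orderIdeal h.1)).wf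
    {h | φ h.1 ≠ 0} ⟨⟨h₁, hh₁⟩, hφ₁⟩
  have hne : h ≠ 0 := fun e => hφ (by simp [e])
  refine ⟨h, hh, hφ, fun b c hc hb hbc => ?_⟩
  obtain ⟨t, ht, hmax⟩ := exists_maximal_smul_le hh hne hb hbc
  refine ⟨t, ht, ?_⟩
  have hp : 0 ≤ b - t • h := sub_nonneg.2 ht
  suffices hz : φ (b - t • h) = 0 by
    rw [map_sub, sub_eq_zero] at hz
    rw [hz, ← map_smul, Complex.coe_smul]
  by_contra hnz
  have hbh : b - t • h ∈ orderIdeal h :=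
    sub_mem (mem_orderIdeal_of_le hh hb hc hbc)
      (Submodule.smul_mem _ _ (mem_orderIdeal_of_le hh hh zero_le_one (by simp)))
  -- By minimality both ideals agree, so `h ≤ d • (b - t • h)`; then `(d⁻¹ + t) • h ≤ b` contradicts
  -- the maximality of `t`.
  have heq := Submodule.eq_of_le_of_finrank_le (orderIdeal_mono hbh)
    (not_lt.1 (hmin ⟨_, hp⟩ hnz))
  have hmem : h ∈ orderIdeal (b - t • h) := by
    rw [heq]; exact mem_orderIdeal_of_le hh hh zero_le_one (by simp)
  obtain ⟨d, hd, -, hle⟩ := hmem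
  have hd' : 0 < d := by
    rcases hd.eq_or_lt with rfl | hd
    · exact absurd (le_antisymm (by simpa using hle) hh) hne
    · exact hd
  have h₂ := smul_le_smul_of_nonneg_left hle (inv_nonneg.2 hd)
  rw [smul_smul, inv_mul_cancel₀ hd'.ne', one_smul, le_sub_iff_add_le, ← add_smul] at h₂
  have := hmax _ h₂
  have := inv_pos.2 hd'
  linarith

theorem exists_star_mul_self_eq {a : A} (ha : 0 ≤ a) : ∃ s : A, a = star s * s :=
  CStarAlgebra.nonneg_iff_eq_star_mul_self.1 ha

theorem IsKPositive.smul {k : ℕ} {φ : A →ₗ[ℂ] B} (hφ : IsKPositive k φ) {c : ℝ} (hc : 0 ≤ c) :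
    IsKPositive k ((c : ℂ) • φ) := by
  intro M hM
  have h := smul_nonneg hc (hφ M hM)
  convert h using 1
  ext i j
  simp [CStarMatrix.map_apply]

/-- A `2`-positive map in terms of the rank-one matrix with entries `star (a i) * a j`. -/
theorem IsKPositive.exists_map_star_mul {φ : A →ₗ[ℂ] B} (hφ : IsKPositive 2 φ) (a : Fin 2 → A) :
    ∃ N : Fin 2 → Fin 2 → B, ∀ i j, φ (star (a i) * a j) = ∑ l, star (N l i) * N l j := by
  -- With first row `a` and second row zero, `star S * S` has entries `star (a i) * a j`.
  let S : CStarMatrix (Fin 2) (Fin 2) A := CStarMatrix.ofMatrix fun i j => if i = 0 then a j else 0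
  obtain ⟨N, hN⟩ := exists_star_mul_self_eq (hφ _ (star_mul_self_nonneg S))
  refine ⟨fun i j => N i j, fun i j => ?_⟩
  have h := congrFun (congrFun hN i) j
  have hS : ∀ i j, S i j = if i = 0 then a j else 0 := fun _ _ => rfl
  simpa [CStarMatrix.map_apply, CStarMatrix.mul_apply, CStarMatrix.star_apply, hS] using h

theorem IsKPositive.isPositive {φ : A →ₗ[ℂ] B} (hφ : IsKPositive 2 φ) : IsPositive φ := by
  intro a ha
  obtain ⟨s, rfl⟩ := exists_star_mul_self_eq ha
  obtain ⟨N, hN⟩ := hφ.exists_map_star_mul fun _ => s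
  rw [hN 0 0]
  exact Finset.sum_nonneg fun l _ => star_mul_self_nonneg _

/-- Inverting the scalar lets properties of `ψ` stable under nonnegative multiples pass to `φ`. -/
theorem IsExtreme.eq_zero_or_exists_smul_eq {φ ψ : A →ₗ[ℂ] B} (hφ : IsExtreme φ)
    (hψ : IsPositive ψ) (h : Majorizes φ ψ) : ψ = 0 ∨ ∃ c : ℝ, 0 ≤ c ∧ φ = (c : ℂ) • ψ := by
  obtain ⟨c, hc, rfl⟩ := hφ ψ hψ h
  rcases eq_or_ne c 0 with rfl | hc0
  · left; simp
  · refine .inr ⟨c⁻¹, inv_nonneg.2 hc, ?_⟩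
    rw [smul_smul, ← Complex.ofReal_mul, inv_mul_cancel₀ hc0, Complex.ofReal_one, one_smul]

end Order

/-! ### Cauchy–Schwarz and the construction of `v` -/

section Hilbert

variable {A : Type*} [CStarAlgebra A] [PartialOrder A] [StarOrderedRing A]
  {H : Type*} [NormedAddCommGroup H] [InnerProductSpace ℂ H] [CompleteSpace H]
  {K : Type*} [NormedAddCommGroup K] [InnerProductSpace ℂ K] [CompleteSpace K]

theorem inner_star_mul (S T : H →L[ℂ] H) (x y : H) : ⟪x, (star S * T) y⟫_ℂ = ⟪S x, T y⟫_ℂ := by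
  change ⟪x, ContinuousLinearMap.adjoint S (T y)⟫_ℂ = _
  rw [ContinuousLinearMap.adjoint_inner_right]

/-- The Cauchy–Schwarz inequality for a `2`-positive map. -/
theorem IsKPositive.norm_inner_map_star_mul_sq_le {φ : A →ₗ[ℂ] (H →L[ℂ] H)}
    (hφ : IsKPositive 2 φ) (a b : A) (x y : H) :
    ‖⟪y, φ (star a * b) x⟫_ℂ‖ ^ 2 ≤
      (⟪y, φ (star a * a) y⟫_ℂ).re * (⟪x, φ (star b * b) x⟫_ℂ).re := by
  obtain ⟨N, hN⟩ := hφ.exists_map_star_mul ![a, b]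
  have key : ∀ i j (u w : H), ⟪u, φ (star (![a, b] i) * ![a, b] j) w⟫_ℂ =
      ∑ l, ⟪N l i u, N l j w⟫_ℂ := by
    intro i j u w
    rw [hN]
    rw [sum_apply, inner_sum]
    exact Finset.sum_congr rfl fun l _ => inner_star_mul _ _ _ _
  have hd : ∀ i (u : H), (⟪u, φ (star (![a, b] i) * ![a, b] i) u⟫_ℂ).re =
      ∑ l, ‖N l i u‖ ^ 2 := by
    intro i u
    rw [key, Complex.re_sum]
    exact Finset.sum_congr rfl fun l _ => by
      rw [inner_self_eq_norm_sq_to_K]; norm_cast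
  have h₀ := hd 0 y
  have h₁ := hd 1 x
  have h₂ := key 0 1 y x
  simp only [Matrix.cons_val_zero, Matrix.cons_val_one] at h₀ h₁ h₂
  rw [h₀, h₁, h₂]
  calc ‖∑ l, ⟪N l 0 y, N l 1 x⟫_ℂ‖ ^ 2 ≤ (∑ l, ‖N l 0 y‖ * ‖N l 1 x‖) ^ 2 := by
        gcongr
        exact (norm_sum_le _ _).trans (Finset.sum_le_sum fun l _ => norm_inner_le_norm _ _)
    _ ≤ _ := Finset.sum_mul_sq_le_sq_mul_sq _ _ _

theorem nonneg_of_inner_eq_ofReal {T : H →L[ℂ] H}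
    (h : ∀ y, ∃ r : ℝ, 0 ≤ r ∧ ⟪y, T y⟫_ℂ = r) : 0 ≤ T := by
  rw [ContinuousLinearMap.nonneg_iff_isPositive, ContinuousLinearMap.isPositive_iff_complex]
  intro y
  obtain ⟨r, hr, he⟩ := h y
  rw [← inner_conj_symm, he]
  simpa using hr

theorem inner_eq_re_of_nonneg {T : H →L[ℂ] H} (hT : 0 ≤ T) (y : H) :
    0 ≤ (⟪y, T y⟫_ℂ).re ∧ ⟪y, T y⟫_ℂ = ((⟪y, T y⟫_ℂ).re : ℂ) := by
  rw [ContinuousLinearMap.nonneg_iff_isPositive] at hT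
  have h := Complex.nonneg_iff.1 (hT.inner_nonneg_right y)
  exact ⟨h.1, Complex.ext rfl (by simpa using h.2.symm)⟩

theorem exists_inner_re_pos {T : H →L[ℂ] H} (hT : 0 ≤ T) (h0 : T ≠ 0) :
    ∃ x, 0 < (⟪x, T x⟫_ℂ).re := by
  by_contra! h
  refine h0 (le_antisymm ?_ hT)
  rw [← neg_nonneg]
  refine nonneg_of_inner_eq_ofReal fun y => ⟨0, le_rfl, ?_⟩
  obtain ⟨h₁, h₂⟩ := inner_eq_re_of_nonneg hT y
  rw [neg_apply, inner_neg_right, h₂, le_antisymm (h y) h₁]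
  simp

theorem inner_map_star_mul (ρ : A →⋆ₙₐ[ℂ] (K →L[ℂ] K)) (a b : A) (x y : K) :
    ⟪x, ρ (star a * b) y⟫_ℂ = ⟪ρ a x, ρ b y⟫_ℂ := by
  rw [map_mul, map_star, inner_star_mul]

theorem inner_map_star_mul_self (ρ : A →⋆ₙₐ[ℂ] (K →L[ℂ] K)) (a : A) (x : K) :
    ⟪x, ρ (star a * a) x⟫_ℂ = ((‖ρ a x‖ ^ 2 : ℝ) : ℂ) := by
  rw [inner_map_star_mul, inner_self_eq_norm_sq_to_K]
  norm_cast

/-- A `*`-representation followed by `Ad v`, as a linear map on `A`. -/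
noncomputable def adComp (ρ : A →⋆ₙₐ[ℂ] (K →L[ℂ] K)) (v : H →L[ℂ] K) :
    A →ₗ[ℂ] (H →L[ℂ] H) :=
  Ad v ∘ₗ (ρ : A →ₗ[ℂ] (K →L[ℂ] K))

theorem adComp_apply (ρ : A →⋆ₙₐ[ℂ] (K →L[ℂ] K)) (v : H →L[ℂ] K) (a : A) :
    adComp ρ v a = Ad v (ρ a) := rfl

theorem adComp_real_smul (ρ : A →⋆ₙₐ[ℂ] (K →L[ℂ] K)) (c : ℝ) (v : H →L[ℂ] K) :
    adComp ρ ((c : ℂ) • v) = ((c ^ 2 : ℝ) : ℂ) • adComp ρ v := by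
  ext a y
  change ContinuousLinearMap.adjoint ((c : ℂ) • v) (ρ a ((c : ℂ) • v y)) =
    ((c ^ 2 : ℝ) : ℂ) • ContinuousLinearMap.adjoint v (ρ a (v y))
  rw [map_smulₛₗ, map_smul, Complex.conj_ofReal, smul_apply, map_smul, smul_smul,
    ← Complex.ofReal_mul, ← sq]

theorem inner_adComp_star_mul_self (ρ : A →⋆ₙₐ[ℂ] (K →L[ℂ] K)) (v : H →L[ℂ] K) (s : A) (y : H) :
    ⟪y, adComp ρ v (star s * s) y⟫_ℂ = ((‖ρ s (v y)‖ ^ 2 : ℝ) : ℂ) := by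
  change ⟪y, ContinuousLinearMap.adjoint v (ρ (star s * s) (v y))⟫_ℂ = _
  rw [ContinuousLinearMap.adjoint_inner_right, inner_map_star_mul_self]

theorem isPositive_adComp (ρ : A →⋆ₙₐ[ℂ] (K →L[ℂ] K)) (v : H →L[ℂ] K) :
    IsPositive (adComp ρ v) := by
  intro a ha
  obtain ⟨s, rfl⟩ := exists_star_mul_self_eq ha
  exact nonneg_of_inner_eq_ofReal fun y => ⟨_, sq_nonneg _, inner_adComp_star_mul_self ρ v s y⟩

theorem majorizes_smul_adComp (ρ : A →⋆ₙₐ[ℂ] (K →L[ℂ] K)) {φ : A →ₗ[ℂ] (H →L[ℂ] H)}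
    (hφ : IsPositive φ) {v : H →L[ℂ] K} {c : ℝ}
    (h : ∀ (a : A) (y : H), ‖ρ a (v y)‖ ^ 2 ≤ c * (⟪y, φ (star a * a) y⟫_ℂ).re) :
    Majorizes ((c : ℂ) • φ) (adComp ρ v) := by
  intro a ha
  obtain ⟨s, rfl⟩ := exists_star_mul_self_eq ha
  refine nonneg_of_inner_eq_ofReal fun y => ⟨_, sub_nonneg.2 (h s y), ?_⟩
  rw [LinearMap.sub_apply, LinearMap.smul_apply, sub_apply, inner_sub_right,
    inner_adComp_star_mul_self, smul_apply, inner_smul_right,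
    (inner_eq_re_of_nonneg (hφ _ ha) y).2]
  push_cast
  simp

/-- Some functional `a ↦ ⟪x, φ (star s * a * s) x⟫`, not vanishing at `1`, is dominated by a
vector functional of the representation. -/
theorem IsPositive.exists_inner_le_vector [FiniteDimensional ℂ A] {φ : A →ₗ[ℂ] (H →L[ℂ] H)}
    (hφ : IsPositive φ) (h0 : φ ≠ 0) {ρ : A →⋆ₙₐ[ℂ] (K →L[ℂ] K)} (hρ : Function.Injective ρ) :
    ∃ (s : A) (x : H) (k : K) (c : ℝ), 0 < c ∧ φ (star s * s) x ≠ 0 ∧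
      ∀ a : A, (⟪x, φ (star (a * s) * (a * s)) x⟫_ℂ).re ≤ c * ‖ρ a k‖ ^ 2 := by
  obtain ⟨h, hh, hφh, hmul⟩ := exists_nonneg_forall_le_map_eq_smul h0
  obtain ⟨s, rfl⟩ := exists_star_mul_self_eq hh
  obtain ⟨x, hx⟩ := exists_inner_re_pos (hφ _ hh) hφh
  have hs : ρ s ≠ 0 := by
    intro e
    rw [map_eq_zero_iff ρ hρ] at e
    exact hφh (by simp [e])
  obtain ⟨k, hk⟩ : ∃ k, ρ s k ≠ 0 := by
    by_contra! e
    exact hs (ContinuousLinearMap.ext e)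
  have hk' : 0 < ‖ρ s k‖ ^ 2 := by positivity
  -- The constant is the ratio of the two functionals at `star s * s`. Below a multiple of that
  -- element `φ` is a scalar `t`, and `t • (star s * s) ≤ star (a * s) * (a * s)` bounds `t` through
  -- `ρ`.
  refine ⟨s, x, ρ s k, _, div_pos hx hk', fun e => by simp [e] at hx, fun a => ?_⟩
  have hle : star (a * s) * (a * s) ≤ ‖star a * a‖ • (star s * s) := by
    have := CStarAlgebra.star_left_conjugate_le_norm_smul (a := s) (b := star a * a)
      (IsSelfAdjoint.star_mul_self a)
    simpa [mul_assoc] using this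
  obtain ⟨t, ht, hφt⟩ := hmul _ _ (norm_nonneg _) (star_mul_self_nonneg (a * s)) hle
  obtain ⟨r, hr⟩ := exists_star_mul_self_eq (sub_nonneg.2 ht)
  have h₁ := inner_map_star_mul_self ρ r k
  rw [← hr, map_sub, sub_apply, inner_sub_right, inner_map_star_mul_self,
    ← Complex.coe_smul, map_smul, smul_apply, inner_smul_right,
    inner_map_star_mul_self] at h₁
  have h₂ : ‖ρ (a * s) k‖ ^ 2 - t * ‖ρ s k‖ ^ 2 = ‖ρ r k‖ ^ 2 := by exact_mod_cast h₁
  have h₃ : t * ‖ρ s k‖ ^ 2 ≤ ‖ρ a (ρ s k)‖ ^ 2 := by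
    have e : ρ (a * s) k = ρ a (ρ s k) := by rw [map_mul]; rfl
    rw [← e]
    nlinarith [sq_nonneg ‖ρ r k‖]
  rw [hφt, smul_apply, inner_smul_right, Complex.re_ofReal_mul,
    div_mul_eq_mul_div, le_div_iff₀ hk']
  nlinarith

theorem _root_.LinearMap.exists_comp_rangeRestrict_eq {𝕜 V W Z : Type*} [Field 𝕜]
    [AddCommGroup V] [Module 𝕜 V] [AddCommGroup W] [Module 𝕜 W] [AddCommGroup Z] [Module 𝕜 Z]
    (R : V →ₗ[𝕜] W) (L : V →ₗ[𝕜] Z) (h : LinearMap.ker R ≤ LinearMap.ker L) :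
    ∃ G : LinearMap.range R →ₗ[𝕜] Z, ∀ a, G (R.rangeRestrict a) = L a := by
  obtain ⟨r, hr⟩ := R.rangeRestrict.exists_rightInverse_of_surjective R.range_rangeRestrict
  refine ⟨L ∘ₗ r, fun a => ?_⟩
  rw [LinearMap.comp_apply, ← sub_eq_zero, ← map_sub]
  refine h ?_
  have h₁ := congrArg Subtype.val (LinearMap.congr_fun hr (R.rangeRestrict a))
  rw [LinearMap.mem_ker, map_sub, sub_eq_zero]
  exact h₁

/-- A nonzero `2`-positive map on a finite dimensional algebra dominates a nonzero map of the
form `Ad v ∘ ρ`, up to a scalar. -/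
theorem IsKPositive.exists_majorizes_adComp [FiniteDimensional ℂ A] [FiniteDimensional ℂ K]
    {φ : A →ₗ[ℂ] (H →L[ℂ] H)} (hφ : IsKPositive 2 φ) (h0 : φ ≠ 0)
    {ρ : A →⋆ₙₐ[ℂ] (K →L[ℂ] K)} (hρ : Function.Injective ρ) :
    ∃ (v : H →L[ℂ] K) (c : ℝ), 0 < c ∧ adComp ρ v ≠ 0 ∧ Majorizes ((c : ℂ) • φ) (adComp ρ v) := by
  obtain ⟨s, x, k, c, hc, hsx, hle⟩ := hφ.isPositive.exists_inner_le_vector h0 hρ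
  let R : A →ₗ[ℂ] K := LinearMap.applyₗ k ∘ₗ ContinuousLinearMap.coeLM ℂ ∘ₗ
    (ρ : A →ₗ[ℂ] (K →L[ℂ] K))
  let L : A →ₗ[ℂ] H := LinearMap.applyₗ x ∘ₗ ContinuousLinearMap.coeLM ℂ ∘ₗ φ ∘ₗ
    LinearMap.mulRight ℂ s
  have hR : ∀ a, R a = ρ a k := fun _ => rfl
  have hL : ∀ a, L a = φ (a * s) x := fun _ => rfl
  have hcs : ∀ (a b : A) (y : H), ‖⟪y, L (star a * b)⟫_ℂ‖ ^ 2 ≤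
      (⟪y, φ (star a * a) y⟫_ℂ).re * (c * ‖R b‖ ^ 2) := by
    intro a b y
    rw [hL, mul_assoc]
    exact (hφ.norm_inner_map_star_mul_sq_le a (b * s) x y).trans
      (mul_le_mul_of_nonneg_left (hle b)
        (inner_eq_re_of_nonneg (hφ.isPositive _ (star_mul_self_nonneg a)) y).1)
  have hker : LinearMap.ker R ≤ LinearMap.ker L := by
    intro b hb
    rw [LinearMap.mem_ker] at hb ⊢
    have h := hcs 1 b (L b)
    rw [hb] at h
    have h' : ‖⟪L b, L b⟫_ℂ‖ ^ 2 ≤ 0 := by simpa using h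
    simpa using h'.antisymm (sq_nonneg _)
  obtain ⟨G, hG⟩ := R.exists_comp_rangeRestrict_eq L hker
  -- The adjoint of `G` takes values in `ρ(A)k`, so each `v y` is some `R d`.
  let v : H →L[ℂ] K := (LinearMap.range R).subtypeL ∘L
    ContinuousLinearMap.adjoint (LinearMap.toContinuousLinearMap G)
  have hv : ∀ a y, ⟪v y, R a⟫_ℂ = ⟪y, L a⟫_ℂ := by
    intro a y
    rw [← hG a]
    exact ContinuousLinearMap.adjoint_inner_left (LinearMap.toContinuousLinearMap G)
      (R.rangeRestrict a) y
  have hvR : ∀ y, ∃ a, R a = v y := fun y =>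
    (ContinuousLinearMap.adjoint (LinearMap.toContinuousLinearMap G) y).2
  have hρR : ∀ a b, ρ a (R b) = R (a * b) := fun a b => by
    rw [hR, hR, map_mul]; rfl
  have hbd : ∀ (a : A) (y : H), ‖ρ a (v y)‖ ^ 2 ≤ c * (⟪y, φ (star a * a) y⟫_ℂ).re := by
    intro a y
    obtain ⟨d, hd⟩ := hvR y
    have h₁ : ⟪y, L (star a * (a * d))⟫_ℂ = ((‖R (a * d)‖ ^ 2 : ℝ) : ℂ) := by
      rw [← hv, ← hd, ← hρR, ← hρR, hd]
      rw [← inner_map_star_mul_self, map_mul]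
      rfl
    have h₂ := hcs a (a * d) y
    rw [h₁, Complex.norm_real, Real.norm_of_nonneg (sq_nonneg _)] at h₂
    rw [← hd, hρR]
    -- `h₂` carries a factor `‖R (a * d)‖ ^ 2` on both sides, cancelled when nonzero.
    rcases (sq_nonneg ‖R (a * d)‖).eq_or_lt with hz | hz
    · rw [← hz]
      exact mul_nonneg hc.le
        (inner_eq_re_of_nonneg (hφ.isPositive _ (star_mul_self_nonneg a)) y).1
    · nlinarith
  refine ⟨v, c, hc, fun hz => ?_, majorizes_smul_adComp ρ hφ.isPositive hbd⟩
  have hv0 : ∀ y, v y = 0 := by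
    intro y
    obtain ⟨d, hd⟩ := hvR y
    have h := inner_adComp_star_mul_self ρ v 1 y
    rw [hz] at h
    have h' : ρ 1 (v y) = 0 := by simpa using h.symm
    -- `ρ` need not be unital, but `ρ 1` fixes the range of `R`.
    rwa [← hd, hρR, one_mul, hd] at h'
  apply hsx
  have h := hv (star s) (φ (star s * s) x)
  rw [hv0, inner_zero_left, hL] at h
  exact inner_self_eq_zero.1 h.symm

/-- An extreme `2`-positive map is of the form `Ad v ∘ ρ`. -/
theorem IsExtreme.exists_eq_Ad [FiniteDimensional ℂ A] [FiniteDimensional ℂ K]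
    {φ : A →ₗ[ℂ] (H →L[ℂ] H)} (hext : IsExtreme φ) (hφ : IsKPositive 2 φ)
    {ρ : A →⋆ₙₐ[ℂ] (K →L[ℂ] K)} (hρ : Function.Injective ρ) :
    ∃ v : H →L[ℂ] K, ∀ a : A, φ a = Ad v (ρ a) := by
  rcases eq_or_ne φ 0 with rfl | h0
  · refine ⟨0, fun a => ?_⟩
    ext y
    simp [Ad]
  obtain ⟨v, c, hc, hv0, hmaj⟩ := hφ.exists_majorizes_adComp h0 hρ
  -- `Ad` is quadratic in `v`, hence the square root.
  set r : ℝ := (Real.sqrt c)⁻¹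
  have hr : r ^ 2 = c⁻¹ := by rw [inv_pow, Real.sq_sqrt hc.le]
  have hmaj' : Majorizes φ (adComp ρ ((r : ℂ) • v)) := by
    intro a ha
    have h := smul_nonneg (inv_nonneg.2 hc.le) (hmaj a ha)
    convert h using 1
    rw [adComp_real_smul, hr, ← Complex.coe_smul, LinearMap.sub_apply, LinearMap.sub_apply,
      smul_sub, LinearMap.smul_apply, LinearMap.smul_apply, smul_smul, ← Complex.ofReal_mul,
      inv_mul_cancel₀ hc.ne', Complex.ofReal_one, one_smul]
  rcases hext.eq_zero_or_exists_smul_eq (isPositive_adComp ρ _) hmaj' with hz | ⟨d, hd, he⟩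
  · rw [adComp_real_smul, hr, smul_eq_zero] at hz
    rcases hz with hz | hz
    · exact absurd hz (by exact_mod_cast (inv_pos.2 hc).ne')
    · exact absurd hz hv0
  · refine ⟨((Real.sqrt d : ℝ) : ℂ) • (r : ℂ) • v, fun a => ?_⟩
    rw [he, ← adComp_apply, adComp_real_smul ρ (Real.sqrt d), Real.sq_sqrt hd]

end Hilbert

/-! ### Transposition, bi-optimality and atomicity -/

section Transpose

variable {H ι : Type*} [NormedAddCommGroup H] [InnerProductSpace ℂ H]
  [FiniteDimensional ℂ H] [CompleteSpace H] [Fintype ι] [DecidableEq ι]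

theorem transpose_transpose (b : OrthonormalBasis ι ℂ H) (x : H →L[ℂ] H) :
    transpose b (transpose b x) = x := by
  ext y
  simp [transpose]

theorem transpose_nonneg (b : OrthonormalBasis ι ℂ H) {x : H →L[ℂ] H} (hx : 0 ≤ x) :
    0 ≤ transpose b x := by
  rw [ContinuousLinearMap.nonneg_iff_isPositive] at hx ⊢
  rw [← ContinuousLinearMap.isPositive_toLinearMap_iff, ← LinearMap.posSemidef_toMatrix_iff b]
    at hx ⊢
  simpa [transpose] using hx.transpose

variable {A : Type*} [CStarAlgebra A] [PartialOrder A] [StarOrderedRing A]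

theorem transpose_comp_transpose_comp (b : OrthonormalBasis ι ℂ H) (φ : A →ₗ[ℂ] (H →L[ℂ] H)) :
    transpose b ∘ₗ (transpose b ∘ₗ φ) = φ :=
  LinearMap.ext fun a => transpose_transpose b (φ a)

theorem IsPositive.transpose_comp (b : OrthonormalBasis ι ℂ H) {φ : A →ₗ[ℂ] (H →L[ℂ] H)}
    (hφ : IsPositive φ) : IsPositive (transpose b ∘ₗ φ) :=
  fun a ha => transpose_nonneg b (hφ a ha)

theorem IsKCoPositive.isPositive (b : OrthonormalBasis ι ℂ H) {φ : A →ₗ[ℂ] (H →L[ℂ] H)}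
    (hφ : IsKCoPositive b 2 φ) : IsPositive φ := by
  rw [← transpose_comp_transpose_comp b φ]
  exact (IsKPositive.isPositive hφ).transpose_comp b

theorem IsKCoPositive.smul {k : ℕ} (b : OrthonormalBasis ι ℂ H) {φ : A →ₗ[ℂ] (H →L[ℂ] H)}
    (hφ : IsKCoPositive b k φ) {c : ℝ} (hc : 0 ≤ c) : IsKCoPositive b k ((c : ℂ) • φ) := by
  have h := IsKPositive.smul hφ hc
  rwa [← LinearMap.comp_smul] at h

/-- The transpose is a positive involution, hence composing with it preserves majorization both
ways. -/
theorem IsExtreme.transpose_comp (b : OrthonormalBasis ι ℂ H) {φ : A →ₗ[ℂ] (H →L[ℂ] H)}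
    (hφ : IsExtreme φ) : IsExtreme (transpose b ∘ₗ φ) := by
  intro ψ hψ hmaj
  have h : Majorizes φ (transpose b ∘ₗ ψ) := by
    have h₁ := IsPositive.transpose_comp b hmaj
    rwa [LinearMap.comp_sub, transpose_comp_transpose_comp] at h₁
  obtain ⟨c, hc, he⟩ := hφ _ (hψ.transpose_comp b) h
  refine ⟨c, hc, ?_⟩
  rw [← LinearMap.comp_smul, ← he, transpose_comp_transpose_comp]

theorem IsExtreme.isBiOptimal (b : OrthonormalBasis ι ℂ H) {φ : A →ₗ[ℂ] (H →L[ℂ] H)}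
    (hext : IsExtreme φ) (h₁ : ¬ IsKPositive 2 φ) (h₂ : ¬ IsKCoPositive b 2 φ) :
    IsBiOptimal b φ := by
  refine ⟨fun ψ hψ hmaj => ?_, fun ψ hψ hmaj => ?_⟩
  · rcases hext.eq_zero_or_exists_smul_eq (hψ 2).isPositive hmaj with h | ⟨c, hc, rfl⟩
    · exact h
    · exact absurd ((hψ 2).smul hc) h₁
  · have hψ₂ : IsKCoPositive b 2 ψ := hψ 2
    rcases hext.eq_zero_or_exists_smul_eq (hψ₂.isPositive b) hmaj with h | ⟨c, hc, rfl⟩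
    · exact h
    · exact absurd (hψ₂.smul b hc) h₂

theorem IsExtreme.isAtomic (b : OrthonormalBasis ι ℂ H) {φ : A →ₗ[ℂ] (H →L[ℂ] H)}
    (hext : IsExtreme φ) (h₁ : ¬ IsKPositive 2 φ) (h₂ : ¬ IsKCoPositive b 2 φ) :
    IsAtomic b φ := by
  rintro ⟨φ₁, φ₂, hφ₁, hφ₂, hsum⟩
  have hmaj : Majorizes φ φ₁ := by
    rw [Majorizes, hsum, add_sub_cancel_left]
    exact hφ₂.isPositive b
  rcases hext.eq_zero_or_exists_smul_eq hφ₁.isPositive hmaj with h | ⟨c, hc, he⟩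
  · rw [h, zero_add] at hsum
    exact h₂ (hsum ▸ hφ₂)
  · exact h₁ (he ▸ hφ₁.smul hc)

end Transpose
end PosMaps

theorem corollary5
    {A : Type*} [CStarAlgebra A] [PartialOrder A] [StarOrderedRing A] [FiniteDimensional ℂ A]
    {H : Type*} [NormedAddCommGroup H] [InnerProductSpace ℂ H]
    [FiniteDimensional ℂ H] [CompleteSpace H]
    {ι : Type*} [Fintype ι] [DecidableEq ι] (b : OrthonormalBasis ι ℂ H)
    {K : Type*} [NormedAddCommGroup K] [InnerProductSpace ℂ K]
    [FiniteDimensional ℂ K] [CompleteSpace K]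
    (ρ : A →⋆ₙₐ[ℂ] (K →L[ℂ] K)) (hρ : Function.Injective ρ)
    (φ : A →ₗ[ℂ] (H →L[ℂ] H)) (hpos : PosMaps.IsPositive φ) (hext : PosMaps.IsExtreme φ) :
    (∃ v : H →L[ℂ] K, ∀ a : A, φ a = PosMaps.Ad v (ρ a)) ∨
    (∃ v : H →L[ℂ] K, ∀ a : A, φ a = PosMaps.transpose b (PosMaps.Ad v (ρ a))) ∨
    (PosMaps.IsBiOptimal b φ ∧ PosMaps.IsAtomic b φ) := by
  by_cases h₁ : PosMaps.IsKPositive 2 φ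
  · exact .inl (hext.exists_eq_Ad h₁ hρ)
  by_cases h₂ : PosMaps.IsKCoPositive b 2 φ
  · obtain ⟨v, hv⟩ := (hext.transpose_comp b).exists_eq_Ad h₂ hρ
    refine .inr (.inl ⟨v, fun a => ?_⟩)
    rw [← hv a]
    exact (PosMaps.transpose_transpose b (φ a)).symm
  · exact .inr (.inr ⟨hext.isBiOptimal b h₁ h₂, hext.isAtomic b h₁ h₂⟩)
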